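/- Let $D$ be any infinite digraph, that is, an infinite set $V$ of vertices together with a set of ordered pairs of vertices, its edges (so there are no multiple edges, but inversely directed edges are allowed; loops, if there are any, play no role). A *strong component* of a digraph is a maximal non-empty strongly connected set of vertices (together with the subdigraph it induces), where a set $W$ of vertices is *strongly connected* if every vertex of $W$ can reach every other vertex of $W$ by a directed path in the subdigraph induced by $W$. For a finite set $X\subseteq V$ let $D-X$ be the digraph obtained from $D$ by deleting the vertices in $X$. A *ray* in $D$ is a sequence $v_0,v_1,v_2,\dots$ of distinct vertices such that $(v_n,v_{n+1})$ is an edge of $D$ for every $n$; its *tails* are the rays $v_N,v_{N+1},\dots$. A ray is *solid* in $D$ if for every finite $X\subseteq V$ it has a tail in some strong component of $D-X$. Two solid rays are *equivalent* if for every finite $X\subseteq V$ they have a tail in the same strong component of $D-X$. The classes of this equivalence relation are the *ends* of $D$; the set of ends is denoted by $\Omega(D)$. For an end $\omega$ and a finite $X\subseteq V$, let $C(X,\omega)$ be the unique strong component of $D-X$ that contains a tail of every solid ray in $\omega$. A *vertex-direction* of $D$ is a map $f$ that sends every finite $X\subseteq V$ to a strong component $f(X)$ of $D-X$ so that $f(X)\supseteq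 f(Y)$ whenever $X\subseteq Y$. For every end $\omega$, the map $f_\omega\colon X\mapsto C(X,\omega)$ is a vertex-direction of $D$. Then the map $\omega\mapsto f_\omega$ is a bijection from $\Omega(D)$ onto the set of vertex-directions of $D$. -/

import Mathlib

namespace Digraph

/-- The edge relation of the induced subdigraph `D[W]`, as a relation on the vertices of `D`. -/
def AdjIn {V : Type*} (D : Digraph V) (W : Set V) (u v : V) : Prop :=
  D.Adj u v ∧ u ∈ W ∧ v ∈ W

/-- `W` is strongly connected in `D`: every vertex of `W` can reach every vertex of `W`
in `D[W]`. -/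
def StronglyConnected {V : Type*} (D : Digraph V) (W : Set V) : Prop :=
  ∀ u ∈ W, ∀ v ∈ W, Relation.ReflTransGen (D.AdjIn W) u v

/-- `C` is (the vertex set of) a strong component of `D - X`: it is maximal among the non-empty
sets of vertices of `D - X` that are strongly connected. -/
def IsStrongComponent {V : Type*} (D : Digraph V) (X : Finset V) (C : Set V) : Prop :=
  Maximal (fun W : Set V => W.Nonempty ∧ Disjoint W (X : Set V) ∧ D.StronglyConnected W) C

theorem AdjIn.mono {V : Type*} {D : Digraph V} {W W' : Set V} (h : W ⊆ W') {u v : V}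
    (huv : D.AdjIn W u v) : D.AdjIn W' u v :=
  ⟨huv.1, h huv.2.1, h huv.2.2⟩

theorem StronglyConnected.union {V : Type*} {D : Digraph V} {W W' : Set V}
    (h : D.StronglyConnected W) (h' : D.StronglyConnected W') {z : V} (hz : z ∈ W)
    (hz' : z ∈ W') : D.StronglyConnected (W ∪ W') := by
  have key : ∀ u ∈ W ∪ W', Relation.ReflTransGen (D.AdjIn (W ∪ W')) u z ∧
      Relation.ReflTransGen (D.AdjIn (W ∪ W')) z u := by
    rintro u (hu | hu)
    · exact ⟨Relation.ReflTransGen.mono (fun _ _ => AdjIn.mono Set.subset_union_left) _ _ (h u hu z hz),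
        Relation.ReflTransGen.mono (fun _ _ => AdjIn.mono Set.subset_union_left) _ _ (h z hz u hu)⟩
    · exact ⟨Relation.ReflTransGen.mono (fun _ _ => AdjIn.mono Set.subset_union_right) _ _ (h' u hu z hz'),
        Relation.ReflTransGen.mono (fun _ _ => AdjIn.mono Set.subset_union_right) _ _ (h' z hz' u hu)⟩
  exact fun u hu v hv => (key u hu).1.trans (key v hv).2

/-- A strong component of `D - Y` that meets a strong component of `D - X`, where `X ⊆ Y`,
is contained in it. -/
theorem IsStrongComponent.subset {V : Type*} {D : Digraph V} {X Y : Finset V} (hXY : X ⊆ Y)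
    {C C' : Set V} (hC : D.IsStrongComponent X C) (hC' : D.IsStrongComponent Y C') {z : V}
    (hz : z ∈ C) (hz' : z ∈ C') : C' ⊆ C := by
  have hd : Disjoint C' (X : Set V) :=
    hC'.prop.2.1.mono_right (Finset.coe_subset.2 hXY)
  have hU : C ∪ C' ⊆ C := hC.le_of_ge
    ⟨⟨z, Or.inl hz⟩, Set.disjoint_union_left.2 ⟨hC.prop.2.1, hd⟩,
      hC.prop.2.2.union hC'.prop.2.2 hz hz'⟩ Set.subset_union_left
  exact Set.subset_union_right.trans hU

/-- A (directed) ray of `D`, given by the sequence of its (distinct) vertices. -/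
structure Ray {V : Type*} (D : Digraph V) where
  /-- The `n`-th vertex of the ray. -/
  vert : ℕ → V
  injective : Function.Injective vert
  adj : ∀ n, D.Adj (vert n) (vert (n + 1))

/-- The ray `R` has a tail in the set `C` of vertices. -/
def Ray.HasTailIn {V : Type*} {D : Digraph V} (R : D.Ray) (C : Set V) : Prop :=
  ∃ N, ∀ n, N ≤ n → R.vert n ∈ C

/-- The ray `R` is solid in `D`. -/
def Ray.IsSolid {V : Type*} {D : Digraph V} (R : D.Ray) : Prop :=
  ∀ X : Finset V, ∃ C, D.IsStrongComponent X C ∧ R.HasTailIn C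

theorem Ray.HasTailIn.exists_common {V : Type*} {D : Digraph V} {R : D.Ray} {C C' : Set V}
    (h : R.HasTailIn C) (h' : R.HasTailIn C') : ∃ z, z ∈ C ∧ z ∈ C' := by
  obtain ⟨N, hN⟩ := h
  obtain ⟨N', hN'⟩ := h'
  exact ⟨R.vert (max N N'), hN _ (le_max_left _ _), hN' _ (le_max_right _ _)⟩

theorem IsStrongComponent.eq_of_hasTailIn {V : Type*} {D : Digraph V} {X : Finset V}
    {C C' : Set V} (hC : D.IsStrongComponent X C) (hC' : D.IsStrongComponent X C') {R : D.Ray}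
    (h : R.HasTailIn C) (h' : R.HasTailIn C') : C = C' := by
  obtain ⟨z, hz, hz'⟩ := h.exists_common h'
  exact (hC'.subset subset_rfl hC hz' hz).antisymm (hC.subset subset_rfl hC' hz hz')

/-- The type of solid rays of `D`. -/
def SolidRay {V : Type*} (D : Digraph V) : Type _ := {R : D.Ray // R.IsSolid}

/-- Two solid rays of `D` are equivalent if, for every finite set `X` of vertices, they have a
tail in the same strong component of `D - X`. -/
def SolidRay.Equiv {V : Type*} {D : Digraph V} (R S : D.SolidRay) : Prop :=
  ∀ X : Finset V, ∃ C, D.IsStrongComponent X C ∧ R.1.HasTailIn C ∧ S.1.HasTailIn C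

/-- Equivalence of solid rays, as a setoid. -/
def solidRaySetoid {V : Type*} (D : Digraph V) : Setoid D.SolidRay where
  r := SolidRay.Equiv
  iseqv :=
    { refl := fun R X => by
        obtain ⟨C, hC, h⟩ := R.2 X
        exact ⟨C, hC, h, h⟩
      symm := fun h X => by
        obtain ⟨C, hC, h1, h2⟩ := h X
        exact ⟨C, hC, h2, h1⟩
      trans := fun h h' X => by
        obtain ⟨C, hC, h1, h2⟩ := h X
        obtain ⟨C', hC', h1', h2'⟩ := h' X
        obtain rfl := hC.eq_of_hasTailIn hC' h2 h1'
        exact ⟨C, hC, h1, h2'⟩ }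

/-- The ends of `D`: the equivalence classes of solid rays. -/
def Ends {V : Type*} (D : Digraph V) : Type _ := Quotient D.solidRaySetoid

/-- The solid ray `R` represents the end `ω`. -/
def SolidRay.Represents {V : Type*} {D : Digraph V} (R : D.SolidRay) (ω : D.Ends) : Prop :=
  Quotient.mk D.solidRaySetoid R = ω

/-- The end `ω` lives in `C`: every solid ray that represents `ω` has a tail in `C`. -/
def Ends.LivesIn {V : Type*} {D : Digraph V} (ω : D.Ends) (C : Set V) : Prop :=
  ∀ R : D.SolidRay, R.Represents ω → R.1.HasTailIn C

theorem Ends.existsUnique_livesIn {V : Type*} {D : Digraph V} (ω : D.Ends) (X : Finset V) :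
    ∃! C, D.IsStrongComponent X C ∧ ω.LivesIn C := by
  obtain ⟨R, hR⟩ : ∃ R : D.SolidRay, R.Represents ω := Quotient.exists_rep ω
  obtain ⟨C, hC, hRC⟩ := R.2 X
  refine ⟨C, ⟨hC, fun S hS => ?_⟩, fun C' h => h.1.eq_of_hasTailIn hC (h.2 R hR) hRC⟩
  have hRS : SolidRay.Equiv R S := Quotient.exact (s := D.solidRaySetoid) (hR.trans hS.symm)
  obtain ⟨C', hC', h1, h2⟩ := hRS X
  obtain rfl := hC.eq_of_hasTailIn hC' hRC h1
  exact h2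

/-- `C(X, ω)`: the unique strong component of `D - X` in which the end `ω` lives. -/
noncomputable def Ends.component {V : Type*} {D : Digraph V} (ω : D.Ends) (X : Finset V) :
    Set V :=
  (ω.existsUnique_livesIn X).choose

theorem Ends.component_spec {V : Type*} {D : Digraph V} (ω : D.Ends) (X : Finset V) :
    D.IsStrongComponent X (ω.component X) ∧ ω.LivesIn (ω.component X) :=
  (ω.existsUnique_livesIn X).choose_spec.1

/-- A vertex-direction of `D`: a map `f` that sends every finite set `X` of vertices to a strong
component of `D - X` so that `f X ⊇ f Y` whenever `X ⊆ Y`. -/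
@[ext]
structure VertexDirection {V : Type*} (D : Digraph V) where
  /-- The underlying map. -/
  toFun : Finset V → Set V
  isStrongComponent : ∀ X, D.IsStrongComponent X (toFun X)
  superset : ∀ X Y, X ⊆ Y → toFun Y ⊆ toFun X

/-- The vertex-direction `f_ω` defined by the end `ω`; it sends `X` to `C(X, ω)`. -/
noncomputable def Ends.direction {V : Type*} {D : Digraph V} (ω : D.Ends) :
    D.VertexDirection where
  toFun X := ω.component X
  isStrongComponent X := (ω.component_spec X).1
  superset X Y hXY := by
    obtain ⟨R, hR⟩ : ∃ R : D.SolidRay, R.Represents ω := Quotient.exists_rep ω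
    obtain ⟨z, hz, hz'⟩ :=
      ((ω.component_spec X).2 R hR).exists_common ((ω.component_spec Y).2 R hR)
    exact (ω.component_spec X).1.subset hXY (ω.component_spec Y).1 hz hz'

end Digraph

/-! Injectivity is immediate: two ends with the same components have equivalent representatives. For
surjectivity it suffices to find a ray with a tail in every `f X` (`VertexDirection.exists_ray`):
such a ray is solid, and its end induces `f`. Since a ray meeting a strong component infinitely
often has a tail in it (`IsStrongComponent.hasTailIn`), the ray only has to meet sets `A k` that
eventually lie in every `f X`. It is the limit of growing paths, each prolonged inside a strongly
connected set that contains its last vertex and avoids all earlier ones.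

The sets `A k` come from a dichotomy on inseparable sets. If these cannot all be met by one finite
set, there are infinitely many disjoint ones, which serve as `A k`. Otherwise some finite `U` meets
them all; then every finite set outside `U` can be separated from `f` without using its own vertices
(`exists_separator`). Iterating this gives finite sets `X n` that pairwise overlap only in `U`, with
decreasing components `f (X n)` of empty intersection, and these components serve as `A k`. -/

namespace Digraph

variable {V : Type*} {D : Digraph V}

/-! ### Paths and rays -/

/-- A walk inside `W` to a vertex of `A` contains a path that meets `A` only in its last vertex. -/
theorem exists_path_to_set {W A : Set V} {s t : V}
    (h : Relation.ReflTransGen (D.AdjIn W) s t) (hs : s ∈ W) (ht : t ∈ A) :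
    ∃ (l : List V) (e : V), (l ++ [e]).head? = some s ∧ (l ++ [e]).IsChain D.Adj ∧
      (l ++ [e]).Nodup ∧ (∀ x ∈ l ++ [e], x ∈ W) ∧ (∀ x ∈ l, x ∉ A) ∧ e ∈ A := by
  induction h using Relation.ReflTransGen.head_induction_on with
  | refl => exact ⟨[], t, by simp, by simp, by simp, by simpa using hs, by simp, ht⟩
  | @head s c hsc hct ih =>
    obtain ⟨l, e, hhead, hchain, hnd, hW, hA, he⟩ := ih hsc.2.2
    by_cases hsA : s ∈ A
    · exact ⟨[], s, by simp, by simp, by simp, by simpa using hs, by simp, hsA⟩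
    -- If the path from `c` already visits `s`, its part from `s` on is the desired path.
    by_cases hsl : s ∈ l ++ [e]
    · have hsl' : s ∈ l := by
        rcases List.mem_append.1 hsl with h | h
        · exact h
        · rw [List.mem_singleton.1 h] at hsA
          exact absurd he hsA
      obtain ⟨a, b, rfl⟩ := List.append_of_mem hsl'
      have hsuf : (s :: b) ++ [e] <:+ (a ++ s :: b) ++ [e] := ⟨a, by simp⟩
      exact ⟨s :: b, e, by simp, hchain.suffix hsuf, hnd.sublist hsuf.sublist,
        fun x hx => hW x (hsuf.subset hx), fun x hx => hA x (List.mem_append_right _ hx), he⟩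
    · refine ⟨s :: l, e, by simp, ?_, ?_, ?_, ?_, he⟩
      · rw [List.cons_append, List.isChain_cons]
        refine ⟨fun y hy => ?_, hchain⟩
        rw [hhead] at hy
        obtain rfl : c = y := by simpa using hy
        exact hsc.1
      · rw [List.cons_append]
        exact List.nodup_cons.2 ⟨hsl, hnd⟩
      · rw [List.cons_append]
        exact List.forall_mem_cons.2 ⟨hs, hW⟩
      · exact List.forall_mem_cons.2 ⟨hsA, hA⟩

/-- A path can be extended inside a strongly connected set `W` that it meets only in its last
vertex to a path that meets `A` only in its last vertex. -/
theorem exists_path_extension {W A : Set V} {Q : List V} {s : V}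
    (hchain : (Q ++ [s]).IsChain D.Adj) (hnd : (Q ++ [s]).Nodup) (hW : D.StronglyConnected W)
    (hsW : s ∈ W) (hQW : ∀ x ∈ Q, x ∉ W) (hAW : (A ∩ W).Nonempty) (hA : ∀ x ∈ Q ++ [s], x ∉ A) :
    ∃ (Q' : List V) (s' : V), (Q' ++ [s']).IsChain D.Adj ∧ (Q' ++ [s']).Nodup ∧
      Q ++ [s] <+: Q' ∧ s' ∈ A ∧ ∀ x ∈ Q', x ∉ A := by
  obtain ⟨t, htA, htW⟩ := hAW
  obtain ⟨l, e, hhead, hc, hn, hlW, hlA, he⟩ := exists_path_to_set (hW s hsW t htW) hsW htA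
  -- As `s ∉ A`, the path into `A` has at least one edge. Hence the whole old path, including `s`,
  -- survives in `Q'`, before the new last vertex.
  obtain _ | ⟨a, M⟩ := l
  · obtain rfl : e = s := by simpa using hhead
    exact absurd he (hA e (by simp))
  obtain rfl : a = s := by simpa using hhead
  refine ⟨Q ++ a :: M, e, ?_, ?_, ⟨M, by simp⟩, he, ?_⟩
  · rw [List.append_assoc, List.cons_append, List.isChain_split]
    exact ⟨hchain, hc⟩
  · rw [List.append_assoc]
    refine List.nodup_append'.2 ⟨(List.nodup_append'.1 hnd).1, hn, ?_⟩
    exact fun x hx hx' => hQW x hx (hlW x hx')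
  · intro x hx
    rcases List.mem_append.1 hx with h | h
    · exact hA x (List.mem_append_left _ h)
    · exact hlA x h

/-- An increasing sequence of paths has a ray as its limit. -/
theorem exists_ray_of_paths (Q : ℕ → List V) (s : ℕ → V)
    (hchain : ∀ k, (Q k ++ [s k]).IsChain D.Adj) (hnd : ∀ k, (Q k ++ [s k]).Nodup)
    (hpre : ∀ k, Q k ++ [s k] <+: Q (k + 1)) :
    ∃ R : D.Ray, ∀ k, ∃ j, k ≤ j ∧ R.vert j = s k := by
  have hlen : ∀ k, k ≤ (Q k).length := by
    intro k
    induction k with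
    | zero => exact Nat.zero_le _
    | succ k ih =>
      have := (hpre k).length_le
      simp only [List.length_append, List.length_singleton] at this
      omega
  have hlt : ∀ k, k < (Q k ++ [s k]).length := fun k => by
    have := hlen k
    simp only [List.length_append, List.length_singleton]
    omega
  have hmono : ∀ m n, m ≤ n → Q m ++ [s m] <+: Q n ++ [s n] := by
    intro m n hmn
    induction n, hmn using Nat.le_induction with
    | base => exact List.prefix_rfl
    | succ n _ ih => exact ih.trans ((hpre n).trans (List.prefix_append _ _))
  have hget : ∀ m j (hj : j < (Q m ++ [s m]).length),
      (Q j ++ [s j])[j]'(hlt j) = (Q m ++ [s m])[j] := by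
    intro m j hj
    rcases le_total j m with h | h
    · exact (hmono j m h).getElem (hlt j)
    · exact ((hmono m j h).getElem hj).symm
  -- Vertex `n` is read off the `n`-th path; by `hget` any path that is long enough gives the same
  -- vertex.
  refine ⟨⟨fun n => (Q n ++ [s n])[n]'(hlt n), fun a b hab => ?_, fun n => ?_⟩, fun k =>
    ⟨(Q k).length, hlen k, ?_⟩⟩
  · have ha : a < (Q (max a b) ++ [s (max a b)]).length :=
      (le_max_left a b).trans_lt (hlt _)
    have hb : b < (Q (max a b) ++ [s (max a b)]).length :=
      (le_max_right a b).trans_lt (hlt _)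
    simp only [hget _ a ha, hget _ b hb] at hab
    exact (hnd _).getElem_inj_iff.1 hab
  · have h1 := hlt (n + 1)
    simp only [hget (n + 1) n (by omega)]
    exact List.isChain_iff_getElem.1 (hchain (n + 1)) n h1
  · have hk : (Q k).length < (Q k ++ [s k]).length := by simp
    simp only [hget k _ hk]
    simp

/-- A ray that meets the sets `A k` for arbitrarily large `k` exists if every path that meets
some `A k` only in its last vertex can be continued to `A m` for all large `m`. -/
theorem exists_ray_frequently_mem (A : ℕ → Set V) (hne : (A 0).Nonempty)
    (hstep : ∀ (k : ℕ) (Q : List V) (s : V), s ∈ A k → (∀ x ∈ Q, x ∉ A k) →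
      ∃ m, k < m ∧ (∀ x ∈ Q ++ [s], x ∉ A m) ∧
        ∃ W, D.StronglyConnected W ∧ s ∈ W ∧ (∀ x ∈ Q, x ∉ W) ∧ (A m ∩ W).Nonempty) :
    ∃ R : D.Ray, ∀ n, ∃ k, n ≤ k ∧ ∃ j, n ≤ j ∧ R.vert j ∈ A k := by
  -- A state is a path that meets `A k` only in its last vertex, together with `k`: exactly what
  -- `hstep` needs, so the continuation can be iterated.
  let State := {p : List V × V × ℕ // (p.1 ++ [p.2.1]).IsChain D.Adj ∧ (p.1 ++ [p.2.1]).Nodup ∧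
    p.2.1 ∈ A p.2.2 ∧ ∀ x ∈ p.1, x ∉ A p.2.2}
  have hnext : ∀ p : State, ∃ q : State,
      p.1.1 ++ [p.1.2.1] <+: q.1.1 ∧ p.1.2.2 < q.1.2.2 := by
    rintro ⟨⟨Q, s, k⟩, hc, hn, hs, hQ⟩
    obtain ⟨m, hkm, hm, W, hW, hsW, hQW, hAW⟩ := hstep k Q s hs hQ
    obtain ⟨Q', s', hc', hn', hpre, hs', hQ'⟩ := exists_path_extension hc hn hW hsW hQW hAW hm
    exact ⟨⟨⟨Q', s', m⟩, hc', hn', hs', hQ'⟩, hpre, hkm⟩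
  choose next hnext_prefix hnext_lt using hnext
  obtain ⟨a, ha⟩ := hne
  let start : State := ⟨⟨[], a, 0⟩, by simp, by simp, ha, by simp⟩
  let st : ℕ → State := fun n => next^[n] start
  have hst : ∀ n, st (n + 1) = next (st n) := fun n => Function.iterate_succ_apply' _ _ _
  have hidx : ∀ n, n ≤ (st n).1.2.2 := by
    intro n
    induction n with
    | zero => exact Nat.zero_le _
    | succ n ih =>
      rw [hst]
      exact Nat.succ_le_of_lt (ih.trans_lt (hnext_lt _))
  obtain ⟨R, hR⟩ := exists_ray_of_paths (D := D) (fun n => (st n).1.1) (fun n => (st n).1.2.1)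
    (fun n => (st n).2.1) (fun n => (st n).2.2.1) (fun n => by
      simp only [hst]
      exact hnext_prefix _)
  refine ⟨R, fun n => ⟨_, hidx n, ?_⟩⟩
  obtain ⟨j, hnj, hj⟩ := hR n
  exact ⟨j, hnj, hj ▸ (st n).2.2.2.1⟩

/-! ### Strong components -/

theorem IsStrongComponent.subset_of_stronglyConnected {X : Finset V} {C W : Set V}
    (hC : D.IsStrongComponent X C) (hW : D.StronglyConnected W) (hWX : Disjoint W (X : Set V))
    {z : V} (hz : z ∈ C) (hzW : z ∈ W) : W ⊆ C :=
  Set.subset_union_right.trans <| hC.le_of_ge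
    ⟨⟨z, Or.inl hz⟩, Set.disjoint_union_left.2 ⟨hC.prop.2.1, hWX⟩, hC.prop.2.2.union hW hz hzW⟩
    Set.subset_union_left

/-- The vertices of one walk suffice. Controlling every vertex of `T` in both directions makes the
union of two such sets, for a walk and a return walk, strongly connected. -/
theorem _root_.Relation.ReflTransGen.exists_finset_adjIn {W : Set V} {u v : V}
    (h : Relation.ReflTransGen (D.AdjIn W) u v) (hu : u ∈ W) :
    ∃ T : Finset V, (T : Set V) ⊆ W ∧ u ∈ T ∧ v ∈ T ∧
      ∀ x ∈ T, Relation.ReflTransGen (D.AdjIn (T : Set V)) u x ∧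
        Relation.ReflTransGen (D.AdjIn (T : Set V)) x v := by
  classical
  induction h with
  | refl =>
    refine ⟨{u}, by simpa using hu, by simp, by simp, fun x hx => ?_⟩
    rw [Finset.mem_singleton.1 hx]
    exact ⟨.refl, .refl⟩
  | @tail b c _ hbc ih =>
    obtain ⟨T, hTW, huT, hbT, hT⟩ := ih
    have hsub : (T : Set V) ⊆ (insert c T : Finset V) := by simp
    have hmono : ∀ x y, Relation.ReflTransGen (D.AdjIn (T : Set V)) x y →
        Relation.ReflTransGen (D.AdjIn ((insert c T : Finset V) : Set V)) x y :=
      Relation.ReflTransGen.mono (fun _ _ => AdjIn.mono hsub)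
    have hbc' : D.AdjIn ((insert c T : Finset V) : Set V) b c :=
      ⟨hbc.1, hsub hbT, by simp⟩
    refine ⟨insert c T, ?_, by simp [huT], by simp, fun x hx => ?_⟩
    · rw [Finset.coe_insert]
      exact Set.insert_subset hbc.2.2 hTW
    · rcases Finset.mem_insert.1 hx with rfl | hx
      · exact ⟨(hmono _ _ (hT b hbT).1).tail hbc', .refl⟩
      · exact ⟨hmono _ _ (hT x hx).1, (hmono _ _ (hT x hx).2).tail hbc'⟩

/-- Any two vertices of a strongly connected set lie in a finite strongly connected subset. -/
theorem StronglyConnected.exists_finset {W : Set V} (hW : D.StronglyConnected W) {u v : V}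
    (hu : u ∈ W) (hv : v ∈ W) :
    ∃ T : Finset V, (T : Set V) ⊆ W ∧ u ∈ T ∧ v ∈ T ∧ D.StronglyConnected (T : Set V) := by
  classical
  obtain ⟨S, hSW, huS, hvS, hS⟩ := (hW u hu v hv).exists_finset_adjIn hu
  obtain ⟨T, hTW, hvT, huT, hT⟩ := (hW v hv u hu).exists_finset_adjIn hv
  have hmonoS : ∀ x y, Relation.ReflTransGen (D.AdjIn (S : Set V)) x y →
      Relation.ReflTransGen (D.AdjIn ((S ∪ T : Finset V) : Set V)) x y :=
    Relation.ReflTransGen.mono (fun _ _ => AdjIn.mono (by simp))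
  have hmonoT : ∀ x y, Relation.ReflTransGen (D.AdjIn (T : Set V)) x y →
      Relation.ReflTransGen (D.AdjIn ((S ∪ T : Finset V) : Set V)) x y :=
    Relation.ReflTransGen.mono (fun _ _ => AdjIn.mono (by simp))
  have huv := hmonoS _ _ (hS u huS).2
  have hvu := hmonoT _ _ (hT v hvT).2
  have key : ∀ x ∈ S ∪ T, Relation.ReflTransGen (D.AdjIn ((S ∪ T : Finset V) : Set V)) u x ∧
      Relation.ReflTransGen (D.AdjIn ((S ∪ T : Finset V) : Set V)) x u := by
    intro x hx
    rcases Finset.mem_union.1 hx with h | h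
    · exact ⟨hmonoS _ _ (hS x h).1, (hmonoS _ _ (hS x h).2).trans hvu⟩
    · exact ⟨huv.trans (hmonoT _ _ (hT x h).1), hmonoT _ _ (hT x h).2⟩
  refine ⟨S ∪ T, ?_, Finset.mem_union_left _ huS, Finset.mem_union_left _ hvS,
    fun x hx y hy => (key x hx).2.trans (key y hy).1⟩
  rw [Finset.coe_union]
  exact Set.union_subset hSW hTW

theorem Ray.reflTransGen_of_le (R : D.Ray) {W : Set V} {a b : ℕ} (hab : a ≤ b)
    (hW : ∀ n, a ≤ n → n ≤ b → R.vert n ∈ W) :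
    Relation.ReflTransGen (D.AdjIn W) (R.vert a) (R.vert b) := by
  induction b, hab using Nat.le_induction with
  | base => exact .refl
  | succ b hab ih =>
    exact (ih fun n h1 h2 => hW n h1 (by omega)).tail
      ⟨R.adj b, hW b hab (by omega), hW (b + 1) (by omega) le_rfl⟩

/-- The part of a ray between two vertices of a strong component of `D - X` lies in this
component if it avoids `X`. -/
theorem IsStrongComponent.ray_segment_subset {X : Finset V} {C : Set V}
    (hC : D.IsStrongComponent X C) (R : D.Ray) {a b : ℕ} (ha : R.vert a ∈ C)
    (hb : R.vert b ∈ C) (hX : ∀ n, a ≤ n → n ≤ b → R.vert n ∉ X) {n : ℕ} (han : a ≤ n)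
    (hnb : n ≤ b) : R.vert n ∈ C := by
  -- The segment `P` leaves `C` and returns to it, so `C ∪ P` is strongly connected and maximality
  -- of `C` applies.
  set P : Set V := Set.image R.vert (Set.Icc a b)
  have hPmem : ∀ n, a ≤ n → n ≤ b → R.vert n ∈ C ∪ P := fun n h1 h2 => Or.inr ⟨n, ⟨h1, h2⟩, rfl⟩
  have hCmono : ∀ x y, Relation.ReflTransGen (D.AdjIn C) x y →
      Relation.ReflTransGen (D.AdjIn (C ∪ P)) x y :=
    Relation.ReflTransGen.mono (fun _ _ => AdjIn.mono Set.subset_union_left)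
  have key : ∀ x ∈ C ∪ P, Relation.ReflTransGen (D.AdjIn (C ∪ P)) (R.vert a) x ∧
      Relation.ReflTransGen (D.AdjIn (C ∪ P)) x (R.vert a) := by
    rintro x (hx | ⟨m, ⟨h1, h2⟩, rfl⟩)
    · exact ⟨hCmono _ _ (hC.prop.2.2 _ ha _ hx), hCmono _ _ (hC.prop.2.2 _ hx _ ha)⟩
    · exact ⟨R.reflTransGen_of_le h1 fun i h3 h4 => hPmem i h3 (h4.trans h2),
        (R.reflTransGen_of_le h2 fun i h3 h4 => hPmem i (h1.trans h3) h4).trans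
          (hCmono _ _ (hC.prop.2.2 _ hb _ ha))⟩
  refine hC.subset_of_stronglyConnected (W := C ∪ P)
    (fun x hx y hy => (key x hx).2.trans (key y hy).1) ?_ ha (Or.inl ha) (hPmem n han hnb)
  refine Set.disjoint_union_left.2 ⟨hC.prop.2.1, Set.disjoint_left.2 ?_⟩
  rintro _ ⟨m, ⟨h1, h2⟩, rfl⟩ hm
  exact hX m h1 h2 hm

theorem Ray.exists_tail_avoiding (R : D.Ray) (X : Finset V) : ∃ N, ∀ n, N ≤ n → R.vert n ∉ X := by
  have hfin : (R.vert ⁻¹' (X : Set V)).Finite :=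
    X.finite_toSet.preimage R.injective.injOn
  obtain ⟨N, hN⟩ := hfin.bddAbove
  exact ⟨N + 1, fun n hn h => absurd (hN h) (by omega)⟩

/-- A ray that meets a strong component of `D - X` infinitely often has a tail in it. -/
theorem IsStrongComponent.hasTailIn {X : Finset V} {C : Set V} (hC : D.IsStrongComponent X C)
    (R : D.Ray) (h : ∀ n, ∃ j, n ≤ j ∧ R.vert j ∈ C) : R.HasTailIn C := by
  obtain ⟨N, hN⟩ := R.exists_tail_avoiding X
  obtain ⟨a, hNa, ha⟩ := h N
  refine ⟨a, fun n han => ?_⟩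
  obtain ⟨b, hnb, hb⟩ := h n
  exact hC.ray_segment_subset R ha hb
    (fun i h1 _ => hN i (hNa.trans h1)) han hnb

/-! ### Vertex-directions -/

namespace VertexDirection

variable (f : D.VertexDirection)

theorem not_mem {X : Finset V} {v : V} (hv : v ∈ X) : v ∉ f.toFun X := fun h =>
  Set.disjoint_left.1 (f.isStrongComponent X).prop.2.1 h hv

/-- If `f Y` avoids `X` then `f Y ⊆ f X`. -/
theorem subset_of_disjoint {X Y : Finset V} (h : Disjoint (f.toFun Y) (X : Set V)) :
    f.toFun Y ⊆ f.toFun X := by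
  classical
  -- The two components meet, since both contain `f (X ∪ Y)`.
  obtain ⟨z, hz⟩ := (f.isStrongComponent (X ∪ Y)).prop.1
  exact (f.isStrongComponent X).subset_of_stronglyConnected (f.isStrongComponent Y).prop.2.2 h
    (f.superset _ _ Finset.subset_union_left hz) (f.superset _ _ Finset.subset_union_right hz)

/-- A finite set `S` is inseparable from `f` if it is non-empty and no finite set of vertices
outside `S` separates a vertex of `S` from `f`. -/
def Inseparable (S : Finset V) : Prop :=
  S.Nonempty ∧ ∀ X : Finset V, Disjoint X S → (S : Set V) ⊆ f.toFun X

/-- A finite set without inseparable subsets can be separated from `f` by a finite set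
disjoint from it. -/
theorem exists_separator (Z : Finset V) (hZ : ∀ S ⊆ Z, ¬ f.Inseparable S) :
    ∃ Y : Finset V, Disjoint Y Z ∧ Disjoint (f.toFun Y) (Z : Set V) := by
  classical
  induction Z using Finset.strongInduction with
  | H Z ih =>
    obtain rfl | hne := Z.eq_empty_or_nonempty
    · exact ⟨∅, by simp, by simp⟩
    have hsep := hZ Z subset_rfl
    simp only [Inseparable, not_and, not_forall] at hsep
    obtain ⟨Y₁, hY₁, hnot⟩ := hsep hne
    obtain ⟨z, hzZ, hz⟩ := Set.not_subset.1 hnot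
    rw [Finset.mem_coe] at hzZ
    obtain ⟨Y₂, hY₂, hf₂⟩ := ih (Z.erase z) (Finset.erase_ssubset hzZ)
      fun S hS => hZ S (hS.trans (Finset.erase_subset _ _))
    -- `Y₂` may contain `z`, which is not allowed in the separator. Deleting it is harmless: `Y₁`
    -- already keeps `z` out of the component, which therefore still avoids all of `Y₂`.
    have hzY : z ∉ f.toFun (Y₁ ∪ Y₂.erase z) := fun h =>
      hz (f.superset _ _ Finset.subset_union_left h)
    have hsub : f.toFun (Y₁ ∪ Y₂.erase z) ⊆ f.toFun Y₂ := by
      refine f.subset_of_disjoint (Set.disjoint_left.2 fun x hx hx' => ?_)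
      by_cases hxz : x = z
      · exact hzY (hxz ▸ hx)
      · exact f.not_mem (Finset.mem_union_right _ (Finset.mem_erase.2 ⟨hxz, hx'⟩)) hx
    refine ⟨Y₁ ∪ Y₂.erase z, ?_, ?_⟩
    · refine Finset.disjoint_union_left.2 ⟨hY₁, Finset.disjoint_left.2 fun x hx hxZ => ?_⟩
      obtain ⟨hxz, hxY⟩ := Finset.mem_erase.1 hx
      exact Finset.disjoint_left.1 hY₂ hxY (Finset.mem_erase.2 ⟨hxz, hxZ⟩)
    · refine Set.disjoint_left.2 fun x hx hxZ => ?_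
      by_cases hxz : x = z
      · exact hzY (hxz ▸ hx)
      · exact Set.disjoint_left.1 hf₂ (hsub hx) (Finset.mem_coe.2 (Finset.mem_erase.2 ⟨hxz, hxZ⟩))

/-- If all inseparable sets meet some finite set, then there are finite sets `X n` such that the
components `f (X n)` are decreasing and have empty intersection. -/
theorem exists_antitone_of_meets {U : Finset V} (hU : ∀ S, f.Inseparable S → ¬ Disjoint S U) :
    ∃ X : ℕ → Finset V, Antitone (fun n => f.toFun (X n)) ∧ ∀ v, ∃ n, v ∉ f.toFun (X n) := by
  classical
  obtain ⟨a, ha⟩ := (f.isStrongComponent U).prop.1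
  have haU : a ∉ U := fun h => f.not_mem h ha
  obtain ⟨X, hX, hr⟩ := exists_seq_of_forall_finset_exists
    (fun Y : Finset V => U ⊆ Y ∧ a ∉ f.toFun Y)
    (fun X Y => Y ∩ X ⊆ U ∧ f.toFun Y ⊆ f.toFun X) (by
      intro s hs
      -- Subsets of this set are disjoint from `U`, hence not inseparable. The separator thus avoids
      -- `a` and all earlier sets outside `U`, while its component together with `U` excludes them.
      obtain ⟨Y, hYZ, hfY⟩ := f.exists_separator (insert a (s.sup id) \ U) fun S hS hins =>
        hU S hins (Finset.disjoint_of_subset_left hS Finset.sdiff_disjoint)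
      have hfYU : ∀ x ∈ insert a (s.sup id), x ∉ f.toFun (Y ∪ U) := by
        intro x hx hxf
        have hxU : x ∉ U := fun h => f.not_mem (Finset.mem_union_right _ h) hxf
        exact Set.disjoint_left.1 hfY (f.superset _ _ Finset.subset_union_left hxf)
          (Finset.mem_coe.2 (Finset.mem_sdiff.2 ⟨hx, hxU⟩))
      refine ⟨Y ∪ U, ⟨Finset.subset_union_right, hfYU a (Finset.mem_insert_self _ _)⟩,
        fun X hXs => ?_⟩
      have hXsub : ∀ x ∈ X, x ∈ insert a (s.sup id) := fun x hx =>
        Finset.mem_insert_of_mem (Finset.le_sup (f := id) hXs hx)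
      refine ⟨fun x hx => ?_, f.subset_of_disjoint
        (Set.disjoint_right.2 fun x hx => hfYU x (hXsub x hx))⟩
      obtain ⟨hxY, hxX⟩ := Finset.mem_inter.1 hx
      by_contra hxU
      exact Finset.disjoint_left.1 hYZ ((Finset.mem_union.1 hxY).resolve_right hxU)
        (Finset.mem_sdiff.2 ⟨hXsub x hxX, hxU⟩))
  refine ⟨X, fun m n hmn => ?_, fun v => ?_⟩
  · rcases hmn.eq_or_lt with rfl | h
    · exact le_rfl
    · exact (hr m n h).2
  by_contra! hv
  -- Were `v` in every `f (X n)`, each `X n` would have to hit the finite set `T` in order to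
  -- separate `a` from `v`. By pigeonhole two of them share a vertex of `T`; it lies in `U`,
  -- although `T ⊆ f U` avoids `U`.
  obtain ⟨T, hTU, haT, hvT, hT⟩ := (f.isStrongComponent U).prop.2.2.exists_finset ha
    (f.superset _ _ (hX 0).1 (hv 0))
  have hmeet : ∀ n, ∃ x ∈ T, x ∈ X n := by
    intro n
    by_contra! h
    exact (hX n).2 ((f.isStrongComponent (X n)).subset_of_stronglyConnected hT
      (Set.disjoint_left.2 h) (hv n) hvT haT)
  choose t htT htX using hmeet
  obtain ⟨m, n, hmn, heq⟩ : ∃ m n, m < n ∧ t m = t n := by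
    obtain ⟨m, n, hne, heq⟩ := Finite.exists_ne_map_eq_of_infinite
      (fun n => (⟨t n, htT n⟩ : T))
    have heq' : t m = t n := congrArg Subtype.val heq
    rcases hne.lt_or_gt with h | h
    · exact ⟨m, n, h, heq'⟩
    · exact ⟨n, m, h, heq'.symm⟩
  have htU : t n ∈ U := (hr m n hmn).1 (Finset.mem_inter.2 ⟨htX n, heq ▸ htX m⟩)
  exact f.not_mem htU (hTU (htT n))

/-- A ray that meets every `f X` infinitely often can be found along a sequence of sets that
eventually lie in every `f X`. -/
theorem exists_ray_of_seq (A : ℕ → Set V) (hne : ∀ k, (A k).Nonempty)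
    (hev : ∀ X : Finset V, ∃ n, ∀ k, n ≤ k → A k ⊆ f.toFun X)
    (hstep : ∀ (k : ℕ) (Q : Finset V), Disjoint (A k) (Q : Set V) →
      ∃ W, D.StronglyConnected W ∧ A k ⊆ W ∧ Disjoint W (Q : Set V) ∧
        ∃ n, ∀ m, n ≤ m → (A m ∩ W).Nonempty) :
    ∃ R : D.Ray, ∀ X, R.HasTailIn (f.toFun X) := by
  classical
  obtain ⟨R, hR⟩ := exists_ray_frequently_mem (D := D) A (hne 0) (by
    intro k Q s hs hQ
    obtain ⟨W, hW, hAW, hWQ, n, hn⟩ := hstep k Q.toFinset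
      (Set.disjoint_right.2 fun x hx => hQ x (by simpa using hx))
    obtain ⟨n', hn'⟩ := hev (Q ++ [s]).toFinset
    -- Beyond `n` the set `A m` meets `W`; beyond `n'` it lies in the component obtained by deleting
    -- the current path, and so misses that path.
    refine ⟨max (k + 1) (max n n'), by omega, fun x hx hxA => ?_, W, hW, hAW hs,
      fun x hx hxW => Set.disjoint_left.1 hWQ hxW (by simpa using hx), hn _ (by omega)⟩
    exact f.not_mem (List.mem_toFinset.2 hx) (hn' _ (by omega) hxA))
  refine ⟨R, fun X => (f.isStrongComponent X).hasTailIn R fun n => ?_⟩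
  obtain ⟨n', hn'⟩ := hev X
  obtain ⟨k, hk, j, hj, hjA⟩ := hR (max n n')
  exact ⟨j, by omega, hn' k (by omega) hjA⟩

/-- Every vertex-direction is followed by a ray. -/
theorem exists_ray : ∃ R : D.Ray, ∀ X, R.HasTailIn (f.toFun X) := by
  classical
  by_cases h : ∀ U : Finset V, ∃ S, f.Inseparable S ∧ Disjoint S U
  · obtain ⟨S, hS, hdis⟩ := exists_seq_of_forall_finset_exists f.Inseparable
      (fun S T : Finset V => Disjoint S T) (by
        intro s _
        obtain ⟨S, hS, hd⟩ := h (s.sup id)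
        exact ⟨S, hS, fun T hT =>
          (Finset.disjoint_of_subset_right (Finset.le_sup (f := id) hT) hd).symm⟩)
    have hev : ∀ X : Finset V, ∃ n, ∀ k, n ≤ k → Disjoint X (S k) := by
      intro X
      induction X using Finset.induction_on with
      | empty => exact ⟨0, by simp⟩
      | insert x X _ ih =>
        obtain ⟨n, hn⟩ := ih
        by_cases hx : ∃ m, x ∈ S m
        · obtain ⟨m, hm⟩ := hx
          refine ⟨max n (m + 1), fun k hk => Finset.disjoint_insert_left.2
            ⟨fun hxk => ?_, hn k (by omega)⟩⟩
          exact Finset.disjoint_left.1 (hdis m k (by omega)) hm hxk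
        · exact ⟨n, fun k hk => Finset.disjoint_insert_left.2 ⟨fun hxk => hx ⟨k, hxk⟩, hn k hk⟩⟩
    have hev' : ∀ X : Finset V, ∃ n, ∀ k, n ≤ k → (S k : Set V) ⊆ f.toFun X := fun X =>
      (hev X).imp fun n hn k hk => (hS k).2 X (hn k hk)
    refine f.exists_ray_of_seq (fun k => (S k : Set V)) (fun k => (hS k).1) hev' fun k Q hQ => ?_
    obtain ⟨n, hn⟩ := hev' Q
    -- Inseparability puts `S k` into `f Q`, because `Q` avoids `S k`; the later sets get there by
    -- `hev'`.
    refine ⟨f.toFun Q, (f.isStrongComponent Q).prop.2.2,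
      (hS k).2 Q (Finset.disjoint_coe.1 hQ).symm, (f.isStrongComponent Q).prop.2.1, n,
      fun m hm => ?_⟩
    obtain ⟨x, hx⟩ := (hS m).1
    exact ⟨x, hx, hn m hm hx⟩
  · push Not at h
    obtain ⟨U, hU⟩ := h
    obtain ⟨X, hanti, hempty⟩ := f.exists_antitone_of_meets hU
    have hne : ∀ k, (f.toFun (X k)).Nonempty := fun k => (f.isStrongComponent (X k)).prop.1
    have hev : ∀ Y : Finset V, ∃ n, Disjoint (f.toFun (X n)) (Y : Set V) := by
      intro Y
      choose g hg using hempty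
      exact ⟨Y.sup g, Set.disjoint_right.2 fun y hy h => hg y (hanti (Finset.le_sup hy) h)⟩
    refine f.exists_ray_of_seq (fun k => f.toFun (X k)) hne (fun Y => ?_) fun k Q hQ => ?_
    · obtain ⟨n, hn⟩ := hev Y
      exact ⟨n, fun k hk => (hanti hk).trans (f.subset_of_disjoint hn)⟩
    · refine ⟨f.toFun (X k), (f.isStrongComponent (X k)).prop.2.2, subset_rfl, hQ, k,
        fun m hm => ?_⟩
      obtain ⟨x, hx⟩ := hne m
      exact ⟨x, hx, hanti hm hx⟩

end VertexDirection

/-! ### Ends and directions -/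

theorem Ends.direction_injective :
    Function.Injective (fun ω : D.Ends => ω.direction) := by
  intro ω ω' h
  obtain ⟨R, hR⟩ : ∃ R : D.SolidRay, R.Represents ω := Quotient.exists_rep ω
  obtain ⟨S, hS⟩ : ∃ S : D.SolidRay, S.Represents ω' := Quotient.exists_rep ω'
  refine hR.symm.trans (Eq.trans (Quotient.sound (s := D.solidRaySetoid) fun X => ?_) hS)
  have hX : ω.component X = ω'.component X :=
    congrFun (congrArg VertexDirection.toFun h) X
  exact ⟨ω.component X, (ω.component_spec X).1, (ω.component_spec X).2 R hR,
    hX ▸ (ω'.component_spec X).2 S hS⟩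

theorem Ends.direction_surjective :
    Function.Surjective (fun ω : D.Ends => ω.direction) := by
  intro f
  obtain ⟨R, hR⟩ := f.exists_ray
  let S : D.SolidRay := ⟨R, fun X => ⟨f.toFun X, f.isStrongComponent X, hR X⟩⟩
  let ω : D.Ends := Quotient.mk D.solidRaySetoid S
  refine ⟨ω, VertexDirection.ext (funext fun X => ?_)⟩
  exact (ω.component_spec X).1.eq_of_hasTailIn (f.isStrongComponent X)
    ((ω.component_spec X).2 S rfl) (hR X)

end Digraph

theorem mainTheorem1 {V : Type*} [Infinite V] (D : Digraph V) :
    Function.Bijective (fun ω : D.Ends => ω.direction) :=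
  ⟨Digraph.Ends.direction_injective, Digraph.Ends.direction_surjective⟩
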